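/- **Theorem.** Let $G$ be a finite directed graph (loops and multiple edges allowed) with vertex set $V$ and edge set $E$. For an edge $e=(i\to j)$ let $v_e\in\mathbb Z^V$ be the vector with $1$ at $i$, $-1$ at $j$ and $0$ elsewhere ($v_e=0$ for a loop), and put $$V_G=\Big\{\lambda:E\to\mathbb R \;\Big|\; \sum_{e\in E}\lambda(e)\,v_e=0\Big\},\qquad H_e=\{\lambda\in V_G:\lambda(e)=0\}\quad(e\in E).$$ Let $L^\perp_G$ be the intersection lattice of the cographic arrangement $\{H_e\}_{e\in E}$, i.e. the set of all intersections of subfamilies of $\{H_e\}$ (including $V_G$ as the empty intersection) ordered by reverse inclusion. The Möbius coinvariant of $G$ is $\mu^\perp(G)=|\mu_{L^\perp_G}(\hat 0,\hat 1)|$, where $\mu_{L^\perp_G}$ is the Möbius function of $L^\perp_G$; by convention $\mu^\perp(G)=0$ if some $H_e$ is not a hyperplane but all of $V_G$ (that is, if some edge $e$ is an isthmus). For $n\ge 0$ let $$H_n(x)=\sum_M x^{a(M)},$$ where $M$ runs over all partial matchings (sets of pairwise disjoint edges, the empty set included) of the complete graph on $n$ vertices and $a(M)$ is the number of vertices lying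 on no edge of $M$; put $H_{-1}(x)=0$. Then for every $m\ge 2$ and every choice of directions of the edges of the complete graph $K_m$ on $m$ vertices, $$\mu^\perp(K_m)=(m-2)\,H_{m-3}(m-1).$$ -/

import Mathlib

open Polynomial

noncomputable section

/-- A directed multigraph with vertex set `V` and edge set `E`: every edge `e` goes from `src e`
to `tgt e`.  Loops and multiple edges are allowed. -/
structure DirectedMultigraph (V E : Type*) where
  src : E → V
  tgt : E → V

namespace DirectedMultigraph

variable {V E : Type*}

/-- `G` is obtained from the simple graph `Γ` by choosing a direction for each of its edges. -/
def IsOrientationOf (G : DirectedMultigraph V E) (Γ : SimpleGraph V) : Prop :=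
  Set.BijOn (fun e => s(G.src e, G.tgt e)) Set.univ Γ.edgeSet

open Classical in
/-- The vector `v_e ∈ ℤ^V` of an edge `e = (i → j)`: it is `1` at `i`, `-1` at `j` and `0`
elsewhere; for a loop it is the zero vector. -/
def edgeVector (G : DirectedMultigraph V E) (e : E) : V → ℤ :=
  Pi.single (G.src e) 1 - Pi.single (G.tgt e) 1

variable [Fintype E]

/-- The real vector space `V_G` of all `c : E → ℝ` with `∑ e, c e • v_e = 0`. -/
def flowSpace (G : DirectedMultigraph V E) : Submodule ℝ (E → ℝ) where
  carrier := {c | ∀ v : V, ∑ e, c e * (G.edgeVector e v : ℝ) = 0}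
  zero_mem' := by simp
  add_mem' := by
    intro a b ha hb v
    simp only [Set.mem_ofPred_eq] at ha hb
    simp only [Pi.add_apply, add_mul, Finset.sum_add_distrib, ha v, hb v, add_zero]
  smul_mem' := by
    intro r a ha v
    simp only [Set.mem_ofPred_eq] at ha
    simp only [Pi.smul_apply, smul_eq_mul, mul_assoc, ← Finset.mul_sum, ha v, mul_zero]

/-- The subspace `H_e = {c ∈ V_G : c e = 0}` of `V_G`. -/
def hyperplane (G : DirectedMultigraph V E) (e : E) : Submodule ℝ G.flowSpace :=
  LinearMap.ker ((LinearMap.proj e : (E → ℝ) →ₗ[ℝ] ℝ) ∘ₗ G.flowSpace.subtype)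

/-- The intersection of the `H_e` with `e ∈ S`; it is all of `V_G` for `S = ∅`. -/
def interHyperplanes (G : DirectedMultigraph V E) (S : Finset E) : Submodule ℝ G.flowSpace :=
  ⨅ e ∈ S, G.hyperplane e

/-- The intersection lattice of the cographic arrangement `{H_e}`: all intersections of
subfamilies of the `H_e`, ordered by reverse inclusion. -/
abbrev IntersectionLattice (G : DirectedMultigraph V E) : Type _ :=
  {X : (Submodule ℝ G.flowSpace)ᵒᵈ // ∃ S : Finset E, X = OrderDual.toDual (G.interHyperplanes S)}

instance (G : DirectedMultigraph V E) : Finite G.IntersectionLattice :=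
  Finite.of_surjective
    (fun S : Finset E => (⟨OrderDual.toDual (G.interHyperplanes S), S, rfl⟩ :
      G.IntersectionLattice))
    (by rintro ⟨X, S, rfl⟩; exact ⟨S, rfl⟩)

instance (G : DirectedMultigraph V E) : BoundedOrder G.IntersectionLattice where
  bot := ⟨OrderDual.toDual (G.interHyperplanes ∅), ∅, rfl⟩
  top := ⟨OrderDual.toDual (G.interHyperplanes Finset.univ), Finset.univ, rfl⟩
  bot_le := by
    rintro ⟨X, S, rfl⟩
    exact (biInf_mono (fun e he => absurd he (Finset.notMem_empty e)) :
      G.interHyperplanes S ≤ G.interHyperplanes ∅)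
  le_top := by
    rintro ⟨X, S, rfl⟩
    exact (biInf_mono (fun e _ => Finset.mem_univ e) :
      G.interHyperplanes Finset.univ ≤ G.interHyperplanes S)

open Classical in
instance (G : DirectedMultigraph V E) : LocallyFiniteOrder G.IntersectionLattice :=
  letI := Fintype.ofFinite G.IntersectionLattice
  Fintype.toLocallyFiniteOrder

open Classical in
/-- The Möbius coinvariant `|μ(0̂, 1̂)|` of `G`, where `μ` is the Möbius function of the
intersection lattice of the cographic arrangement.  If some `H_e` is all of `V_G` (that is, `e` is
an isthmus of `G`), then `H_e` is not a hyperplane and the coinvariant is `0`, the usual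
convention for the Möbius invariant of an arrangement with a degenerate hyperplane, i.e. of a
matroid with a loop. -/
def moebiusCoinvariant (G : DirectedMultigraph V E) : ℤ :=
  if ∃ e, G.hyperplane e = ⊤ then 0
  else |IncidenceAlgebra.mu ℤ (⊥ : G.IntersectionLattice) ⊤|

end DirectedMultigraph

open Classical in
/-- The partial matchings of a finite simple graph: the sets of pairwise disjoint edges. -/
def partialMatchings {V : Type*} [Fintype V] (Γ : SimpleGraph V) : Finset (Finset (Sym2 V)) :=
  Finset.univ.filter fun M : Finset (Sym2 V) => (∀ e ∈ M, e ∈ Γ.edgeSet) ∧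
    ∀ e ∈ M, ∀ f ∈ M, e ≠ f → ∀ v, ¬ (v ∈ e ∧ v ∈ f)

open Classical in
/-- `a(M)`: the number of vertices that lie on no edge of `M`. -/
def unmatchedCount {V : Type*} [Fintype V] (M : Finset (Sym2 V)) : ℕ :=
  (Finset.univ.filter fun v : V => ∀ e ∈ M, v ∉ e).card

/-- The Hermite polynomial `H_n`: the generating function `∑ x ^ a(M)` of the partial matchings
`M` of the complete graph on `n` vertices if `n ≥ 0`, and `0` for negative indices (only
`H_{-1} = 0` matters). -/
def matchingHermite : ℤ → ℤ[X]
  | Int.ofNat n => ∑ M ∈ partialMatchings (⊤ : SimpleGraph (Fin n)), X ^ unmatchedCount M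
  | Int.negSucc _ => 0

end

/-! By Whitney's formula μ(0̂, 1̂) is the sum of (-1)^|S| over the edge sets S whose hyperplanes
meet only in 0. A flow vanishing on S is a linear relation among the edge vectors outside S, so
these S are the complements of forests. Up to sign, the coinvariant is therefore the sum of (-1)^|F|
over the forests F in K_m (`abs_mu_bot_top_eq_abs_indepSum`).

To compute this sum, fix a root r among n + 1 vertices, give the edges at r the weight x and all
others the weight -1, and let P_n(x) be the weighted forest sum. Differentiating marks an edge {r,
i}. Contracting it makes {r, j} and {i, j} parallel, with total weight x - 1, so P_n'(x) = n
P_{n-1}(x - 1) (`derivative_rootedForestPoly`). At x = 0 the root is isolated, so P_n(0) =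
P_{n-1}(-1) (`eval_zero_rootedForestPoly`). These two equations give P_n(x) = (H_n + H_n')(x + 1 -
n) (`rootedForestPoly_eq`). Setting x = -1 and n = m - 1, parity and the three-term recurrence of
the Hermite polynomials leave ±(m - 2) H_{m-3}(m - 1). -/

open Classical in
/-- The weighted sum `∑ ∏ i ∈ S, w i` over the index sets `S` for which the vectors `v i`, `i ∈ S`,
are linearly independent. -/
noncomputable def indepSum {ι M R : Type*} [Fintype ι] [AddCommGroup M] [Module ℝ M] [CommRing R]
    (v : ι → M) (w : ι → R) : R :=
  ∑ S ∈ Finset.univ.filter (fun S : Finset ι => LinearIndepOn ℝ v (S : Set ι)), ∏ i ∈ S, w i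

/-! ### Weighted sums over independent sets: parallel elements and contraction -/

section IndepSum

variable {ι κ M N R R' : Type*} [AddCommGroup M] [Module ℝ M]
  [AddCommGroup N] [Module ℝ N] [CommRing R] [CommRing R']

lemma linearIndepOn_smul_iff {v v' : ι → M} {c : ι → ℝ} (hc : ∀ i, c i ≠ 0)
    (h : ∀ i, v i = c i • v' i) (S : Set ι) : LinearIndepOn ℝ v S ↔ LinearIndepOn ℝ v' S := by
  have := LinearIndependent.units_smul_iff (fun i : S => v' i) (fun i : S => Units.mk0 (c i) (hc i))
  unfold LinearIndepOn
  rw [← this]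
  have e : (fun i : S => v i) = ((fun i : S => Units.mk0 (c i) (hc i)) • fun i : S => v' i) := by
    funext i
    simp [h, Units.smul_def]
  rw [e]

lemma linearIndepOn_comp_iff (u : κ → M) (f : ι → κ) (S : Set ι) :
    LinearIndepOn ℝ (fun i => u (f i)) S ↔ Set.InjOn f S ∧ LinearIndepOn ℝ u (f '' S) := by
  constructor
  · intro h
    exact ⟨Set.InjOn.of_comp (g := u) h.injOn, h.image_of_comp⟩
  · rintro ⟨h1, h2⟩
    exact h2.comp_of_image h1

/-- This is matroid contraction: a relation among the images lifts to one among the original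
vectors, with a suitable coefficient at `v i`. -/
lemma linearIndepOn_insert_iff_of_ker_eq_span [DecidableEq ι] {v : ι → M} {φ : M →ₗ[ℝ] N} {i : ι}
    (hv : v i ≠ 0) (hφ : LinearMap.ker φ = Submodule.span ℝ {v i}) {S : Finset ι} (hi : i ∉ S) :
    LinearIndepOn ℝ v ((insert i S : Finset ι) : Set ι)
      ↔ LinearIndepOn ℝ (fun j => φ (v j)) (S : Set ι) := by
  have hφi : φ (v i) = 0 := by
    rw [← LinearMap.mem_ker, hφ]
    exact Submodule.mem_span_singleton_self _
  rw [linearIndepOn_finset_iff, linearIndepOn_finset_iff]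
  constructor
  · intro h f hf j hj
    have hmem : ∑ j ∈ S, f j • v j ∈ LinearMap.ker φ := by
      simpa [LinearMap.mem_ker, map_sum] using hf
    rw [hφ, Submodule.mem_span_singleton] at hmem
    obtain ⟨a, ha⟩ := hmem
    have := h (fun j => if j = i then -a else f j) ?_ j (Finset.mem_insert_of_mem hj)
    · rwa [if_neg (fun hji => hi (by rwa [hji] at hj))] at this
    · rw [Finset.sum_insert hi, if_pos rfl,
        Finset.sum_congr rfl (g := fun j => f j • v j) fun j hj => by
          rw [if_neg (fun hji => hi (by rwa [hji] at hj))], ← ha]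
      simp
  · intro h f hf
    rw [Finset.sum_insert hi] at hf
    have h0 : ∀ j ∈ S, f j = 0 := by
      refine h f ?_
      have := congrArg φ hf
      simpa [map_sum, hφi] using this
    rw [Finset.sum_eq_zero fun j hj => by rw [h0 j hj, zero_smul], add_zero] at hf
    intro j hj
    rcases Finset.mem_insert.1 hj with rfl | hj
    · exact (smul_eq_zero.1 hf).resolve_right hv
    · exact h0 j hj

variable [Fintype ι]

lemma map_indepSum (g : R →+* R') (v : ι → M) (w : ι → R) :
    g (indepSum v w) = indepSum v (fun i => g (w i)) := by
  simp [indepSum, map_sum, map_prod]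

/-- A zero vector lies in no independent set. Hence the weights of diagonal pairs may be ignored
below. -/
lemma indepSum_congr {v : ι → M} {w w' : ι → R} (h : ∀ i, v i ≠ 0 → w i = w' i) :
    indepSum v w = indepSum v w' := by
  classical
  refine Finset.sum_congr rfl fun S hS => Finset.prod_congr rfl fun i hi => h i ?_
  exact (Finset.mem_filter.1 hS).2.ne_zero (by simpa using hi)

lemma indepSum_comp_injective (φ : M →ₗ[ℝ] N) (hφ : Function.Injective φ) (v : ι → M) (w : ι → R) :
    indepSum (fun i => φ (v i)) w = indepSum v w := by
  classical
  unfold indepSum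
  congr 1
  ext S
  simp only [Finset.mem_filter, Finset.mem_univ, true_and]
  exact φ.linearIndepOn_iff_of_injOn hφ.injOn

-- A set mapped bijectively onto `T` is a choice of one point in each fibre over `T`, so the
-- identity is the expansion of a product of sums.
open Classical in
lemma sum_prod_image_eq [DecidableEq κ] (f : ι → κ) (w : ι → R) (T : Finset κ) :
    ∑ S ∈ Finset.univ.filter (fun S : Finset ι => Set.InjOn f (S : Set ι) ∧ S.image f = T), ∏ i ∈ S, w i
      = ∏ k ∈ T, ∑ i with f i = k, w i := by
  rw [Finset.prod_sum]
  symm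
  refine Finset.sum_bij (fun p _ => T.attach.image fun k => p k.1 k.2) ?_ ?_ ?_ ?_
  · intro p hp
    have hp' : ∀ k (hk : k ∈ T), f (p k hk) = k := fun k hk => by
      simpa using Finset.mem_pi.1 hp k hk
    simp only [Finset.mem_filter, Finset.mem_univ, true_and]
    constructor
    · intro a ha b hb hab
      simp only [Finset.coe_image, Set.mem_image] at ha hb
      obtain ⟨⟨k, hk⟩, -, rfl⟩ := ha
      obtain ⟨⟨l, hl⟩, -, rfl⟩ := hb
      simp only [hp'] at hab
      subst hab
      rfl
    · ext k
      simp only [Finset.mem_image, Finset.mem_attach, true_and, Subtype.exists]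
      constructor
      · rintro ⟨_, ⟨l, hl, rfl⟩, rfl⟩
        rwa [hp']
      · intro hk
        exact ⟨_, ⟨k, hk, rfl⟩, hp' k hk⟩
  · intro p hp q hq hpq
    have hp' : ∀ k (hk : k ∈ T), f (p k hk) = k := fun k hk => by
      simpa using Finset.mem_pi.1 hp k hk
    have hq' : ∀ k (hk : k ∈ T), f (q k hk) = k := fun k hk => by
      simpa using Finset.mem_pi.1 hq k hk
    funext k hk
    have : p k hk ∈ T.attach.image fun k => q k.1 k.2 := by
      rw [← hpq]
      exact Finset.mem_image.2 ⟨⟨k, hk⟩, Finset.mem_attach _ _, rfl⟩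
    obtain ⟨⟨l, hl⟩, -, h⟩ := Finset.mem_image.1 this
    have : l = k := by rw [← hq' l hl, ← hp' k hk]; exact congrArg f h
    subst this
    exact h.symm
  · intro S hS
    obtain ⟨hinj, rfl⟩ := (Finset.mem_filter.1 hS).2
    have hex : ∀ k ∈ S.image f, ∃ i ∈ S, f i = k := fun k hk => Finset.mem_image.1 hk
    refine ⟨fun k hk => (hex k hk).choose, ?_, ?_⟩
    · refine Finset.mem_pi.2 fun k hk => ?_
      simpa using (hex k hk).choose_spec.2
    · ext i
      simp only [Finset.mem_image, Finset.mem_attach, true_and, Subtype.exists]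
      constructor
      · rintro ⟨k, hk, rfl⟩
        exact (hex k (Finset.mem_image.2 hk)).choose_spec.1
      · intro hi
        have hk : f i ∈ S.image f := Finset.mem_image_of_mem f hi
        exact ⟨f i, Finset.mem_image.1 hk, hinj (hex _ hk).choose_spec.1 hi (hex _ hk).choose_spec.2⟩
  · intro p hp
    have hp' : ∀ k (hk : k ∈ T), f (p k hk) = k := fun k hk => by
      simpa using Finset.mem_pi.1 hp k hk
    rw [Finset.prod_image]
    rintro ⟨k, hk⟩ - ⟨l, hl⟩ - h
    have := congrArg f h
    simp only [hp'] at this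
    exact Subtype.ext this

variable [Fintype κ]

open Classical in
/-- Parallel vectors can be merged into one by adding their weights. -/
lemma indepSum_eq_indepSum_fiber [DecidableEq κ] {v : ι → M} {u : κ → M} (f : ι → κ) {c : ι → ℝ}
    (hc : ∀ i, c i ≠ 0) (h : ∀ i, v i = c i • u (f i)) (w : ι → R) :
    indepSum v w = indepSum u (fun k => ∑ i with f i = k, w i) := by
  unfold indepSum
  simp_rw [← sum_prod_image_eq, linearIndepOn_smul_iff hc h, linearIndepOn_comp_iff u f]
  rw [← Finset.sum_fiberwise_of_maps_to (g := fun S : Finset ι => S.image f)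
    (t := Finset.univ.filter fun T : Finset κ => LinearIndepOn ℝ u (T : Set κ))]
  · refine Finset.sum_congr rfl fun T hT => ?_
    refine Finset.sum_congr ?_ fun _ _ => rfl
    ext S
    simp only [Finset.mem_filter, Finset.mem_univ, true_and] at hT ⊢
    constructor
    · rintro ⟨⟨h1, h2⟩, h3⟩
      exact ⟨h1, h3⟩
    · rintro ⟨h1, rfl⟩
      exact ⟨⟨h1, by simpa using hT⟩, rfl⟩
  · intro S hS
    simp only [Finset.mem_filter, Finset.mem_univ, true_and] at hS ⊢
    simpa using hS.2

open Classical in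
lemma sum_prod_erase_eq_indepSum [DecidableEq ι] {v : ι → M} {φ : M →ₗ[ℝ] N} {i : ι}
    (hv : v i ≠ 0) (hφ : LinearMap.ker φ = Submodule.span ℝ {v i}) (w : ι → R) :
    ∑ S ∈ Finset.univ.filter (fun S : Finset ι => LinearIndepOn ℝ v (S : Set ι) ∧ i ∈ S), ∏ j ∈ S.erase i, w j
      = indepSum (fun j => φ (v j)) w := by
  have hφi : φ (v i) = 0 := by
    rw [← LinearMap.mem_ker, hφ]
    exact Submodule.mem_span_singleton_self _
  have hnot : ∀ S : Finset ι, LinearIndepOn ℝ (fun j => φ (v j)) (S : Set ι) → i ∉ S :=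
    fun S hS hi => hS.ne_zero (by simpa using hi) hφi
  unfold indepSum
  refine Finset.sum_bij' (fun S _ => S.erase i) (fun S _ => insert i S) ?_ ?_ ?_ ?_ ?_
  · intro S hS
    simp only [Finset.mem_filter, Finset.mem_univ, true_and] at hS ⊢
    rw [← linearIndepOn_insert_iff_of_ker_eq_span hv hφ (Finset.notMem_erase i S),
      Finset.insert_erase hS.2]
    exact hS.1
  · intro S hS
    simp only [Finset.mem_filter, Finset.mem_univ, true_and] at hS ⊢
    exact ⟨(linearIndepOn_insert_iff_of_ker_eq_span hv hφ (hnot S hS)).2 hS,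
      Finset.mem_insert_self _ _⟩
  · intro S hS
    exact Finset.insert_erase (Finset.mem_filter.1 hS).2.2
  · intro S hS
    exact Finset.erase_insert (hnot S (Finset.mem_filter.1 hS).2)
  · intro S hS
    rfl

open Classical in
lemma derivative_indepSum [DecidableEq ι] (v : ι → M) (w : ι → R[X]) :
    derivative (indepSum v w) = ∑ i, (∑ S ∈ Finset.univ.filter (fun S : Finset ι => LinearIndepOn ℝ v (S : Set ι) ∧ i ∈ S),
      ∏ j ∈ S.erase i, w j) * derivative (w i) := by
  simp only [indepSum, derivative_sum, derivative_prod_finset, Finset.sum_mul]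
  rw [Finset.sum_sigma', Finset.sum_sigma']
  refine Finset.sum_bij' (fun p _ => ⟨p.2, p.1⟩) (fun p _ => ⟨p.2, p.1⟩) ?_ ?_ ?_ ?_ ?_ <;> simp

end IndepSum

/-! ### Spanning forests of the complete graph -/

/-- The vector `e_a - e_b` of an unordered pair `s(a, b)`, for an arbitrary choice of the order of
its two elements. -/
noncomputable def pairVector {V : Type*} (z : Sym2 V) : V →₀ ℝ :=
  Finsupp.single (Quot.out z).1 1 - Finsupp.single (Quot.out z).2 1

open Classical in
/-- The weight `y` on the pairs that contain `r` and `-1` on the others. -/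
noncomputable def rootWeight {V R : Type*} [CommRing R] (r : V) (y : R) (z : Sym2 V) : R :=
  if r ∈ z then y else -1

section Forest

variable {V V' R : Type*} [CommRing R]

lemma exists_single_sub_single_eq_smul_pairVector (a b : V) : ∃ c : ℝ, c ≠ 0 ∧
    (Finsupp.single a 1 - Finsupp.single b 1 : V →₀ ℝ) = c • pairVector s(a, b) := by
  have h : s((Quot.out s(a, b)).1, (Quot.out s(a, b)).2) = s(a, b) := Quot.out_eq s(a, b)
  rw [Sym2.eq_iff] at h
  unfold pairVector
  rcases h with ⟨h1, h2⟩ | ⟨h1, h2⟩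
  · exact ⟨1, one_ne_zero, by rw [h1, h2, one_smul]⟩
  · exact ⟨-1, by norm_num, by rw [h1, h2, neg_one_smul, neg_sub]⟩

lemma exists_mapDomain_pairVector_eq_smul (π : V → V') (z : Sym2 V) : ∃ c : ℝ, c ≠ 0 ∧
    Finsupp.lmapDomain ℝ ℝ π (pairVector z) = c • pairVector (z.map π) := by
  obtain ⟨c, hc, h⟩ := exists_single_sub_single_eq_smul_pairVector
    (π (Quot.out z).1) (π (Quot.out z).2)
  have hz : s((Quot.out z).1, (Quot.out z).2) = z := Quot.out_eq z
  refine ⟨c, hc, ?_⟩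
  rw [← Sym2.map_mk, hz] at h
  rw [← h, pairVector, map_sub]
  simp [Finsupp.lmapDomain_apply, Finsupp.mapDomain_single]

lemma single_sub_single_eq_zero_iff (a b : V) :
    (Finsupp.single a 1 - Finsupp.single b 1 : V →₀ ℝ) = 0 ↔ a = b := by
  rw [sub_eq_zero, Finsupp.single_left_inj one_ne_zero]

lemma pairVector_mk_eq_zero_iff (a b : V) : pairVector s(a, b) = 0 ↔ a = b := by
  obtain ⟨c, hc, h⟩ := exists_single_sub_single_eq_smul_pairVector a b
  rw [← single_sub_single_eq_zero_iff a b, h, smul_eq_zero, or_iff_right hc]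

open Classical in
/-- The map that moves `i` to `r` and fixes all other points. -/
noncomputable def collapse {i r : V} (h : r ≠ i) (v : V) : {v : V // v ≠ i} :=
  if hv : v = i then ⟨r, h⟩ else ⟨v, hv⟩

lemma collapse_eq_root_iff {i r : V} (h : r ≠ i) (v : V) :
    collapse h v = ⟨r, h⟩ ↔ v = r ∨ v = i := by
  unfold collapse
  split_ifs with hv <;> simp [hv]

lemma collapse_eq_iff {i r : V} (h : r ≠ i) (v : V) {a : {v : V // v ≠ i}} (ha : a ≠ ⟨r, h⟩) :
    collapse h v = a ↔ v = a := by
  unfold collapse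
  split_ifs with hv
  · subst hv
    exact ⟨fun h => absurd h.symm ha, fun h => absurd h.symm a.2⟩
  · exact ⟨fun h => congrArg Subtype.val h, fun h => Subtype.ext h⟩

lemma ker_lmapDomain_collapse {i r : V} (h : r ≠ i) :
    LinearMap.ker (Finsupp.lmapDomain ℝ ℝ (collapse h)) = Submodule.span ℝ {pairVector s(i, r)} := by
  obtain ⟨c, hc, hcv⟩ := exists_single_sub_single_eq_smul_pairVector i r
  have hspan : Submodule.span ℝ {pairVector s(i, r)}
      = Submodule.span ℝ {(Finsupp.single i 1 - Finsupp.single r 1 : V →₀ ℝ)} := by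
    rw [hcv, Submodule.span_singleton_smul_eq (IsUnit.mk0 c hc)]
  rw [hspan]
  apply le_antisymm
  · intro x hx
    -- Every x is its collapsed image, included back, plus x(i)(e_i - e_r). On the kernel only the
    -- second term survives.
    have key : LinearMap.id = (Finsupp.lmapDomain ℝ ℝ (Subtype.val : {v : V // v ≠ i} → V)) ∘ₗ
        Finsupp.lmapDomain ℝ ℝ (collapse h) + LinearMap.toSpanSingleton ℝ (V →₀ ℝ)
          (Finsupp.single i 1 - Finsupp.single r 1) ∘ₗ Finsupp.lapply i := by
      refine Finsupp.lhom_ext' fun v => LinearMap.ext_ring ?_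
      by_cases hv : v = i
      · subst hv
        simp [collapse, Finsupp.mapDomain_single]
      · simp [collapse, hv, Finsupp.mapDomain_single]
    have := LinearMap.congr_fun key x
    rw [LinearMap.mem_ker] at hx
    simp only [LinearMap.id_apply, LinearMap.add_apply, LinearMap.comp_apply, hx, map_zero,
      zero_add, LinearMap.toSpanSingleton_apply] at this
    rw [this]
    exact Submodule.smul_mem _ _ (Submodule.mem_span_singleton_self _)
  · rw [Submodule.span_singleton_le_iff_mem, LinearMap.mem_ker]
    rw [map_sub]
    simp [collapse, Finsupp.lmapDomain_apply, Finsupp.mapDomain_single, h]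

variable [Fintype V]

-- For `b` off the root, {r, b} and {i, b} both map to {r, b}, and their weights `y` and -1 add up
-- to `y - 1`. A non-diagonal pair avoiding the root has a single preimage, of weight -1.
open Classical in
lemma sum_rootWeight_fiber_collapse {i r : V} (h : r ≠ i) (y : R)
    {z' : Sym2 {v : V // v ≠ i}} (hz' : pairVector z' ≠ 0) :
    ∑ z with Sym2.map (collapse h) z = z', rootWeight r y z
      = rootWeight (⟨r, h⟩ : {v : V // v ≠ i}) (y - 1) z' := by
  have root : ∀ b : {v : V // v ≠ i}, b ≠ ⟨r, h⟩ →
      ∑ z with Sym2.map (collapse h) z = s(⟨r, h⟩, b), rootWeight r y z = y - 1 := by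
    intro b hb
    have hbr : (b : V) ≠ r := fun hbr => hb (Subtype.ext hbr)
    have hfib : (Finset.univ.filter fun z => Sym2.map (collapse h) z = s(⟨r, h⟩, b))
        = {s(r, (b : V)), s(i, (b : V))} := by
      ext z
      induction z with | _ p q
      simp only [Finset.mem_filter, Finset.mem_univ, true_and, Finset.mem_insert,
        Finset.mem_singleton, Sym2.map_mk, Sym2.eq_iff, collapse_eq_root_iff,
        collapse_eq_iff h _ hb]
      tauto
    rw [hfib, Finset.sum_pair]
    · simp [rootWeight, h, hbr.symm, sub_eq_add_neg]
    · rw [Ne, Sym2.eq_iff]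
      rintro (⟨h1, -⟩ | ⟨h1, -⟩)
      exacts [h h1, hbr h1.symm]
  induction z' with | _ a b
  rw [Ne, pairVector_mk_eq_zero_iff] at hz'
  by_cases ha : a = ⟨r, h⟩
  · subst ha
    rw [root b (Ne.symm hz')]
    simp [rootWeight]
  by_cases hb : b = ⟨r, h⟩
  · subst hb
    rw [Sym2.eq_swap, root a hz']
    simp [rootWeight]
  have hfib : (Finset.univ.filter fun z => Sym2.map (collapse h) z = s(a, b))
      = {s((a : V), (b : V))} := by
    ext z
    induction z with | _ p q
    simp only [Finset.mem_filter, Finset.mem_univ, true_and,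
      Finset.mem_singleton, Sym2.map_mk, Sym2.eq_iff, collapse_eq_iff h _ hb,
      collapse_eq_iff h _ ha]
  rw [hfib, Finset.sum_singleton]
  have ha' : r ≠ a := fun e => ha (Subtype.ext e.symm)
  have hb' : r ≠ b := fun e => hb (Subtype.ext e.symm)
  simp [rootWeight, ha', hb', Ne.symm ha, Ne.symm hb]

open Classical in
lemma indepSum_collapse {i r : V} (h : r ≠ i) (y : R) :
    indepSum (fun z => Finsupp.lmapDomain ℝ ℝ (collapse h) (pairVector z)) (rootWeight r y)
      = indepSum pairVector (rootWeight (⟨r, h⟩ : {v : V // v ≠ i}) (y - 1)) := by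
  choose c hc hcv using exists_mapDomain_pairVector_eq_smul (collapse h)
  rw [indepSum_eq_indepSum_fiber (Sym2.map (collapse h)) hc hcv]
  exact indepSum_congr fun z' hz' => sum_rootWeight_fiber_collapse h y hz'

-- Weight 0 on the edges at `r` kills every forest that uses one, which amounts to deleting `r`.
open Classical in
lemma indepSum_rootWeight_zero (r : V) :
    indepSum pairVector (rootWeight r (0 : R))
      = indepSum (pairVector (V := {v : V // v ≠ r})) (fun _ => (-1 : R)) := by
  rw [← indepSum_comp_injective (Finsupp.lmapDomain ℝ ℝ (Subtype.val : {v : V // v ≠ r} → V))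
    (Finsupp.mapDomain_injective Subtype.val_injective)]
  choose c hc hcv using exists_mapDomain_pairVector_eq_smul (Subtype.val : {v : V // v ≠ r} → V)
  rw [indepSum_eq_indepSum_fiber (Sym2.map Subtype.val) hc hcv]
  refine indepSum_congr fun z _ => ?_
  induction z with | _ p q
  by_cases hr : r ∈ s(p, q)
  · rw [Finset.sum_eq_zero]
    · simp [rootWeight, hr]
    · intro z' hz'
      have := (Finset.mem_filter.1 hz').2
      rw [← this, Sym2.mem_map] at hr
      obtain ⟨a, -, ha⟩ := hr
      exact absurd ha a.2
  · have hp : p ≠ r := by rintro rfl; exact hr (Sym2.mem_mk_left _ _)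
    have hq : q ≠ r := by rintro rfl; exact hr (Sym2.mem_mk_right _ _)
    have hfib : (Finset.univ.filter fun z : Sym2 {v : V // v ≠ r} =>
        Sym2.map Subtype.val z = s(p, q)) = {s(⟨p, hp⟩, ⟨q, hq⟩)} := by
      ext z
      simp only [Finset.mem_filter, Finset.mem_univ, true_and, Finset.mem_singleton]
      rw [← (Sym2.map.injective Subtype.val_injective).eq_iff (a := z)]
      simp
    rw [hfib, Finset.sum_singleton, rootWeight, if_neg hr]

/-- The sum of `(-1) ^ (n - d) * X ^ d` over the spanning forests of the complete graph on `V`,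
where `d` is the degree of the root `r` and `n` the number of edges of the forest. -/
noncomputable def rootedForestPoly (r : V) : ℤ[X] := indepSum pairVector (rootWeight r X)

lemma rootedForestPoly_comp (r : V) (p : ℤ[X]) :
    (rootedForestPoly r).comp p = indepSum pairVector (rootWeight r p) := by
  rw [← coe_compRingHom_apply, rootedForestPoly, map_indepSum]
  congr 1
  funext z
  unfold rootWeight
  split_ifs <;> simp

lemma eval_rootedForestPoly (r : V) (x : ℤ) :
    (rootedForestPoly r).eval x = indepSum pairVector (rootWeight r x) := by
  rw [← coe_evalRingHom, rootedForestPoly, map_indepSum]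
  congr 1
  funext z
  unfold rootWeight
  split_ifs <;> simp

lemma eval_neg_one_rootedForestPoly (r : V) :
    (rootedForestPoly r).eval (-1) = indepSum (pairVector (V := V)) (fun _ => (-1 : ℤ)) := by
  rw [eval_rootedForestPoly]
  congr 1
  funext z
  simp [rootWeight]

-- After `r` is deleted all weights are -1. At -1 the root is not distinguished, so any remaining
-- vertex can serve as the new root.
open Classical in
lemma eval_zero_rootedForestPoly {i r : V} (h : i ≠ r) :
    (rootedForestPoly r).eval 0 = (rootedForestPoly (⟨i, h⟩ : {v : V // v ≠ r})).eval (-1) := by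
  rw [eval_rootedForestPoly, indepSum_rootWeight_zero, eval_neg_one_rootedForestPoly]

lemma rootedForestPoly_of_subsingleton [Subsingleton V] (r : V) : rootedForestPoly r = 1 := by
  classical
  have h0 : ∀ z : Sym2 V, pairVector z = 0 := fun z => by
    induction z with | _ p q
    rw [pairVector_mk_eq_zero_iff]
    exact Subsingleton.elim _ _
  rw [rootedForestPoly, indepSum, Finset.sum_eq_single ∅]
  · simp
  · intro S hS hne
    obtain ⟨z, hz⟩ := Finset.nonempty_iff_ne_empty.2 hne
    exact absurd (h0 z) ((Finset.mem_filter.1 hS).2.ne_zero (by simpa using hz))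
  · intro h
    exact absurd (Finset.mem_filter.2 ⟨Finset.mem_univ _, by simp⟩) h

-- The product rule marks one edge {r, i} of the forest and removes its weight; the remaining edges
-- form a forest in the contraction of that edge.
open Classical in
lemma derivative_rootedForestPoly (r : V) :
    derivative (rootedForestPoly r) = ∑ i : {i : V // r ≠ i},
      (rootedForestPoly (⟨r, i.2⟩ : {v : V // v ≠ i})).comp (X - 1) := by
  rw [rootedForestPoly, derivative_indepSum]
  have hinj : Function.Injective fun i : {i : V // r ≠ i} => s((i : V), r) := by
    intro i j hij
    have := Sym2.congr_left.1 hij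
    exact Subtype.ext this
  rw [← Finset.sum_subset (Finset.subset_univ
    (Finset.univ.map ⟨fun i : {i : V // r ≠ i} => s((i : V), r), hinj⟩)), Finset.sum_map]
  · refine Finset.sum_congr rfl fun i _ => ?_
    simp only [Function.Embedding.coeFn_mk]
    rw [sum_prod_erase_eq_indepSum (φ := Finsupp.lmapDomain ℝ ℝ (collapse i.2)) _
      (ker_lmapDomain_collapse i.2), indepSum_collapse, rootedForestPoly_comp]
    · simp [rootWeight]
    · rw [Ne, pairVector_mk_eq_zero_iff]
      exact i.2.symm
  -- The other pairs contribute nothing: off the root the weight is constant, and the diagonal pair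
  -- at `r` has zero vector.
  · intro z _ hz
    by_cases hr : r ∈ z
    · obtain ⟨q, rfl⟩ := Sym2.mem_iff_exists.1 hr
      have hq : r = q := by
        by_contra hq
        refine hz (Finset.mem_map.2 ⟨⟨q, hq⟩, Finset.mem_univ _, ?_⟩)
        exact Sym2.eq_swap
      subst hq
      rw [Finset.sum_eq_zero, zero_mul]
      intro S hS
      obtain ⟨h1, h2⟩ := (Finset.mem_filter.1 hS).2
      exact absurd ((pairVector_mk_eq_zero_iff r r).2 rfl) (h1.ne_zero (by simpa using h2))
    · simp [rootWeight, hr]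

end Forest

/-! ### Hermite polynomials and their recurrences -/

/-- The polynomials `H_n` given by `H_0 = 1` and `H_{n+1} = X * H_n + H_n'`. -/
noncomputable def hermitePlus : ℕ → ℤ[X]
  | 0 => 1
  | n + 1 => X * hermitePlus n + derivative (hermitePlus n)

lemma hermitePlus_succ (n : ℕ) :
    hermitePlus (n + 1) = X * hermitePlus n + derivative (hermitePlus n) := rfl

lemma derivative_hermitePlus_succ (n : ℕ) :
    derivative (hermitePlus (n + 1)) = (n + 1 : ℤ[X]) * hermitePlus n := by
  induction n with
  | zero => simp [hermitePlus]
  | succ n ih =>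
    rw [hermitePlus_succ (n + 1), derivative_add, derivative_mul, derivative_X, ih, derivative_mul,
      hermitePlus_succ n]
    simp only [derivative_add, derivative_natCast, derivative_one]
    push_cast
    ring

lemma hermitePlus_add_two (n : ℕ) :
    hermitePlus (n + 2) = X * hermitePlus (n + 1) + (n + 1 : ℤ[X]) * hermitePlus n := by
  rw [hermitePlus_succ, derivative_hermitePlus_succ]

lemma eval_neg_hermitePlus (n : ℕ) (x : ℤ) :
    (hermitePlus n).eval (-x) = (-1) ^ n * (hermitePlus n).eval x := by
  induction n using Nat.twoStepInduction with
  | zero => simp [hermitePlus]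
  | one => simp [hermitePlus]
  | more n ih1 ih2 =>
    simp only [hermitePlus_add_two, eval_add, eval_mul, eval_X, eval_natCast, eval_one, ih1, ih2]
    ring

/-! ### Generating functions of matchings -/

section Matchings

variable {V : Type*} [Fintype V]

open Classical in
/-- The matchings of the complete graph all of whose edges lie in `s`. -/
noncomputable def matchingsOn (s : Finset V) : Finset (Finset (Sym2 V)) :=
  (partialMatchings (⊤ : SimpleGraph V)).filter fun M => ∀ e ∈ M, ∀ v ∈ e, v ∈ s

open Classical in
/-- The generating function of the matchings in `s` by the number of unmatched points of `s`. -/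
noncomputable def matchingSum (s : Finset V) : ℤ[X] :=
  ∑ M ∈ matchingsOn s, X ^ (s.filter fun v => ∀ e ∈ M, v ∉ e).card

lemma mem_matchingsOn {s : Finset V} {M : Finset (Sym2 V)} :
    M ∈ matchingsOn s ↔ (∀ e ∈ M, ¬ e.IsDiag) ∧
      (∀ e ∈ M, ∀ f ∈ M, ∀ v, v ∈ e → v ∈ f → e = f) ∧ ∀ e ∈ M, ∀ v ∈ e, v ∈ s := by
  simp only [matchingsOn, partialMatchings, Finset.mem_filter, Finset.mem_univ, true_and,
    SimpleGraph.edgeSet_top, Set.mem_compl_iff, and_assoc]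
  refine and_congr (by simp) (and_congr ?_ Iff.rfl)
  refine forall₂_congr fun e _ => forall₂_congr fun f _ => ?_
  constructor
  · intro h v h1 h2
    by_contra hne
    exact h hne v ⟨h1, h2⟩
  · rintro h hne v ⟨h1, h2⟩
    exact hne (h v h1 h2)

lemma notMem_of_mem_matchingsOn {s : Finset V} {M : Finset (Sym2 V)} (hM : M ∈ matchingsOn s)
    {r : V} (hr : r ∉ s) : ∀ e ∈ M, r ∉ e :=
  fun e he hre => hr ((mem_matchingsOn.1 hM).2.2 e he r hre)

open Classical in
lemma insert_mem_matchingsOn {s : Finset V} {r j : V} (hr : r ∉ s) (hj : j ∈ s)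
    {M : Finset (Sym2 V)} (hM : M ∈ matchingsOn (s.erase j)) :
    insert s(r, j) M ∈ matchingsOn (insert r s) := by
  have hrM := notMem_of_mem_matchingsOn hM (fun h => hr (Finset.mem_of_mem_erase h) : r ∉ s.erase j)
  have hjM := notMem_of_mem_matchingsOn hM (Finset.notMem_erase j s)
  obtain ⟨h1, h2, h3⟩ := mem_matchingsOn.1 hM
  have hdisj : ∀ f ∈ M, ∀ v, v ∈ s(r, j) → v ∉ f := by
    intro f hf v hv
    rcases Sym2.mem_iff.1 hv with rfl | rfl
    exacts [hrM f hf, hjM f hf]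
  refine mem_matchingsOn.2 ⟨?_, ?_, ?_⟩
  · simp only [Finset.mem_insert, forall_eq_or_imp]
    refine ⟨?_, h1⟩
    rw [Sym2.mk_isDiag_iff]
    rintro rfl
    exact hr hj
  · intro e he f hf v hve hvf
    rcases Finset.mem_insert.1 he with rfl | he <;> rcases Finset.mem_insert.1 hf with rfl | hf
    · rfl
    · exact absurd hvf (hdisj f hf v hve)
    · exact absurd hve (hdisj e he v hvf)
    · exact h2 e he f hf v hve hvf
  · intro e he v hv
    rcases Finset.mem_insert.1 he with rfl | he
    · rcases Sym2.mem_iff.1 hv with rfl | rfl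
      exacts [Finset.mem_insert_self _ _, Finset.mem_insert_of_mem hj]
    · exact Finset.mem_insert_of_mem (Finset.mem_of_mem_erase (h3 e he v hv))

open Classical in
lemma erase_mem_matchingsOn {s : Finset V} {r j : V} {M : Finset (Sym2 V)}
    (hM : M ∈ matchingsOn (insert r s)) (hrj : s(r, j) ∈ M) :
    M.erase s(r, j) ∈ matchingsOn (s.erase j) := by
  obtain ⟨h1, h2, h3⟩ := mem_matchingsOn.1 hM
  refine mem_matchingsOn.2 ⟨fun e he => h1 e (Finset.mem_of_mem_erase he),
    fun e he f hf => h2 e (Finset.mem_of_mem_erase he) f (Finset.mem_of_mem_erase hf), ?_⟩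
  intro e he v hv
  obtain ⟨hne, he⟩ := Finset.mem_erase.1 he
  have hvn : v ∉ s(r, j) := fun h => hne (h2 e he _ hrj v hv h)
  rw [Sym2.mem_iff, not_or] at hvn
  exact Finset.mem_erase.2 ⟨hvn.2, (Finset.mem_insert.1 (h3 e he v hv)).resolve_left hvn.1⟩

-- Either `r` is unmatched, contributing a factor X, or it is matched to some `j`, and the rest is a
-- matching of `s` without `j`.
open Classical in
lemma matchingSum_insert {s : Finset V} {r : V} (hr : r ∉ s) :
    matchingSum (insert r s) = X * matchingSum s + ∑ j ∈ s, matchingSum (s.erase j) := by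
  rw [matchingSum, ← Finset.sum_filter_add_sum_filter_not _ (fun M => ∀ e ∈ M, r ∉ e)]
  congr 1
  · have hset : (matchingsOn (insert r s)).filter (fun M => ∀ e ∈ M, r ∉ e) = matchingsOn s := by
      ext M
      rw [Finset.mem_filter]
      constructor
      · rintro ⟨hM, hrM⟩
        obtain ⟨h1, h2, h3⟩ := mem_matchingsOn.1 hM
        refine mem_matchingsOn.2 ⟨h1, h2, fun e he v hv => ?_⟩
        refine (Finset.mem_insert.1 (h3 e he v hv)).resolve_left ?_
        rintro rfl
        exact hrM e he hv
      · intro hM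
        refine ⟨?_, notMem_of_mem_matchingsOn hM hr⟩
        obtain ⟨h1, h2, h3⟩ := mem_matchingsOn.1 hM
        exact mem_matchingsOn.2 ⟨h1, h2, fun e he v hv => Finset.mem_insert_of_mem (h3 e he v hv)⟩
    rw [hset, matchingSum, Finset.mul_sum]
    refine Finset.sum_congr rfl fun M hM => ?_
    rw [Finset.filter_insert, if_pos (notMem_of_mem_matchingsOn hM hr), Finset.card_insert_of_notMem
      (fun h => hr (Finset.mem_of_mem_filter _ h)), pow_succ']
  · simp only [matchingSum]
    rw [Finset.sum_sigma']
    symm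
    refine Finset.sum_bij (fun p _ => insert s(r, p.1) p.2) ?_ ?_ ?_ ?_
    · rintro ⟨j, M⟩ hM
      obtain ⟨hj, hM⟩ := Finset.mem_sigma.1 hM
      refine Finset.mem_filter.2 ⟨insert_mem_matchingsOn hr hj hM, fun h => ?_⟩
      exact h _ (Finset.mem_insert_self _ _) (Sym2.mem_mk_left _ _)
    · rintro ⟨j, M⟩ hM ⟨j', M'⟩ hM' heq
      obtain ⟨hj, hM⟩ := Finset.mem_sigma.1 hM
      obtain ⟨hj', hM'⟩ := Finset.mem_sigma.1 hM'
      simp only at hj hM hj' hM' heq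
      have hn : ∀ k i (N : Finset (Sym2 V)), N ∈ matchingsOn (s.erase k) → s(r, i) ∉ N :=
        fun k i N hN h => notMem_of_mem_matchingsOn hN
          (fun h => hr (Finset.mem_of_mem_erase h) : r ∉ s.erase k) _ h (Sym2.mem_mk_left _ _)
      have hmem : s(r, j) ∈ insert s(r, j') M' := heq ▸ Finset.mem_insert_self _ _
      have hjj : j = j' :=
        Sym2.congr_right.1 ((Finset.mem_insert.1 hmem).resolve_right (hn _ _ _ hM'))
      subst hjj
      have : M = M' := by
        rw [← Finset.erase_insert (hn _ j _ hM), heq, Finset.erase_insert (hn _ j _ hM')]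
      rw [this]
    · intro M hM
      obtain ⟨hM, hrM⟩ := Finset.mem_filter.1 hM
      push Not at hrM
      obtain ⟨e, he, hre⟩ := hrM
      obtain ⟨j, rfl⟩ := Sym2.mem_iff_exists.1 hre
      obtain ⟨h1, h2, h3⟩ := mem_matchingsOn.1 hM
      have hj : j ∈ s := by
        refine (Finset.mem_insert.1 (h3 _ he j (Sym2.mem_mk_right _ _))).resolve_left ?_
        rintro rfl
        exact h1 _ he (by simp)
      exact ⟨⟨j, M.erase s(r, j)⟩, Finset.mem_sigma.2 ⟨hj, erase_mem_matchingsOn hM he⟩,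
        Finset.insert_erase he⟩
    · rintro ⟨j, M⟩ hM
      obtain ⟨hj, hM⟩ := Finset.mem_sigma.1 hM
      congr 2
      ext v
      simp only [Finset.mem_filter, Finset.mem_erase, Finset.mem_insert, forall_eq_or_imp,
        Sym2.mem_iff]
      constructor
      · rintro ⟨⟨h1, h2⟩, h3⟩
        exact ⟨Or.inr h2, fun h => h.elim (fun h => hr (h ▸ h2)) h1, h3⟩
      · rintro ⟨h1, h2, h3⟩
        rw [not_or] at h2
        exact ⟨⟨h2.2, h1.resolve_left h2.1⟩, h3⟩

lemma matchingSum_eq_hermitePlus (n : ℕ) : ∀ s : Finset V, s.card = n →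
    matchingSum s = hermitePlus n := by
  classical
  induction n using Nat.strong_induction_on with
  | _ n ih =>
    intro s hs
    rcases s.eq_empty_or_nonempty with rfl | ⟨r, hr⟩
    · subst hs
      have h : matchingsOn (∅ : Finset V) = {∅} := by
        ext M
        rw [mem_matchingsOn, Finset.mem_singleton]
        constructor
        · rintro ⟨-, -, h⟩
          refine Finset.eq_empty_of_forall_notMem fun e he => ?_
          induction e with | _ p q
          exact absurd (h _ he p (Sym2.mem_mk_left _ _)) (Finset.notMem_empty _)
        · rintro rfl
          simp
      simp [matchingSum, h, hermitePlus]
    · obtain ⟨t, hrt, rfl⟩ : ∃ t, r ∉ t ∧ insert r t = s :=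
        ⟨s.erase r, Finset.notMem_erase _ _, Finset.insert_erase hr⟩
      rw [Finset.card_insert_of_notMem hrt] at hs
      subst hs
      rw [matchingSum_insert hrt, ih _ (Nat.lt_succ_self _) t rfl,
        Finset.sum_congr rfl fun j hj => ih (t.card - 1) (by omega) (t.erase j)
          (Finset.card_erase_of_mem hj), Finset.sum_const]
      -- For empty `t` the truncated index `t.card - 1` is harmless, since the sum has no terms.
      rcases h : t.card with _ | k
      · simp [hermitePlus]
      · rw [hermitePlus_add_two, nsmul_eq_mul]
        simp

end Matchings

lemma matchingHermite_natCast (n : ℕ) : matchingHermite n = hermitePlus n := by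
  rw [← matchingSum_eq_hermitePlus n (Finset.univ : Finset (Fin n)) (by simp)]
  change ∑ M ∈ partialMatchings (⊤ : SimpleGraph (Fin n)), X ^ unmatchedCount M = _
  simp [matchingSum, matchingsOn, unmatchedCount]

/-! ### Evaluation of the forest sum -/

lemma Polynomial.eq_of_derivative_eq_of_eval_zero_eq {p q : ℤ[X]}
    (h : derivative p = derivative q) (h0 : p.eval 0 = q.eval 0) : p = q := by
  have hd : derivative (p - q) = 0 := by rw [derivative_sub, h, sub_self]
  have hc := eq_C_of_natDegree_eq_zero (derivative_eq_zero.1 hd)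
  rw [coeff_zero_eq_eval_zero, eval_sub, h0, sub_self, C_0] at hc
  exact sub_eq_zero.1 hc

/-- A polynomial over ℤ is determined by its derivative and its value at 0. The derivatives agree
because H_{n+1}' = (n + 1) H_n, and the shift by 1 under contraction becomes the shift of the
argument with `n`. -/
lemma rootedForestPoly_eq (n : ℕ) : ∀ {V : Type*} [Fintype V] (r : V), Fintype.card V = n + 1 →
    rootedForestPoly r
      = (hermitePlus n + derivative (hermitePlus n)).comp (X + 1 - (n : ℤ[X])) := by
  classical
  induction n with
  | zero =>
    intro V _ r hV
    have : Subsingleton V := Fintype.card_le_one_iff_subsingleton.1 hV.le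
    simp [rootedForestPoly_of_subsingleton, hermitePlus]
  | succ n ih =>
    intro V _ r hV
    have hcard : ∀ i : V, Fintype.card {v : V // v ≠ i} = n + 1 := fun i => by
      simp [hV]
    have hcard' : Fintype.card {i : V // r ≠ i} = n + 1 := by
      rw [← hcard r]
      exact Fintype.card_congr (Equiv.subtypeEquivRight fun _ => ne_comm)
    apply eq_of_derivative_eq_of_eval_zero_eq
    · rw [derivative_rootedForestPoly, Finset.sum_congr rfl fun i _ => by
        rw [ih _ (hcard i)], Finset.sum_const, Finset.card_univ, hcard', derivative_comp,
        derivative_add, derivative_hermitePlus_succ]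
      simp only [derivative_mul, derivative_add, derivative_sub, zero_mul, zero_add, derivative_natCast, derivative_one,
        derivative_X, comp_assoc, add_comp, sub_comp, mul_comp, natCast_comp, X_comp, one_comp,
        nsmul_eq_mul, Nat.cast_add, Nat.cast_one]
      have e : (X - 1 + 1 - (n : ℤ[X])) = X + 1 - ((n : ℤ[X]) + 1) := by ring
      rw [e]
      ring
    -- Both arguments become -n, where H_{n+1} + (n + 1) H_n = H_n + H_n' by the recursion defining
    -- H_{n+1}.
    · obtain ⟨i, hi⟩ := Fintype.exists_ne_of_one_lt_card (by omega : 1 < Fintype.card V) r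
      rw [eval_zero_rootedForestPoly hi, ih _ (hcard r), derivative_hermitePlus_succ,
        hermitePlus_succ]
      simp only [eval_comp, eval_add, eval_sub, eval_mul, eval_X, eval_natCast, eval_one,
        Nat.cast_add, Nat.cast_one]
      have e1 : (-1 + 1 - (n : ℤ)) = -n := by ring
      have e2 : (0 + 1 - ((n : ℤ) + 1)) = -n := by ring
      rw [e1, e2]
      ring

/-- The value at -1 is (H_{n+1} + (n + 1) H_n)(-(n + 1)). Parity turns it into ±(H_{n+1} - (n + 1)
H_n)(n + 1), and the three-term recurrence cancels all but n H_{n-1}(n + 1). -/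
lemma indepSum_pairVector_neg_one {V : Type*} [Fintype V] {n : ℕ}
    (hV : Fintype.card V = n + 2) :
    indepSum (pairVector (V := V)) (fun _ => (-1 : ℤ))
      = (-1) ^ (n + 1) * (n * (matchingHermite ((n : ℤ) - 1)).eval ((n : ℤ) + 1)) := by
  obtain ⟨r⟩ : Nonempty V := Fintype.card_pos_iff.1 (by omega)
  rw [← eval_neg_one_rootedForestPoly r, rootedForestPoly_eq (n + 1) r hV,
    derivative_hermitePlus_succ]
  have e : ((-1 : ℤ) + 1 - ((n : ℤ) + 1)) = -(n + 1) := by ring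
  simp only [eval_comp, eval_add, eval_sub, eval_mul, eval_X, eval_natCast, eval_one,
    Nat.cast_add, Nat.cast_one, e, eval_neg_hermitePlus]
  rcases n with _ | k
  · simp [hermitePlus]
  · have e' : (((k + 1 : ℕ) : ℤ) - 1) = (k : ℤ) := by push_cast; ring
    rw [e', matchingHermite_natCast, hermitePlus_add_two]
    simp only [eval_add, eval_mul, eval_X, eval_natCast, eval_one]
    push_cast
    ring

/-! ### Whitney's formula for the Möbius function -/

lemma IncidenceAlgebra.mu_bot_eq_of_sum_Icc {α : Type*} [PartialOrder α] [OrderBot α] [Finite α]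
    [LocallyFiniteOrder α] [DecidableEq α] {g : α → ℤ}
    (hg : ∀ x, ∑ y ∈ Finset.Icc ⊥ x, g y = if ⊥ = x then 1 else 0) (x : α) :
    IncidenceAlgebra.mu ℤ ⊥ x = g x := by
  induction x using WellFoundedLT.induction with
  | _ x ih =>
    have h := (IncidenceAlgebra.sum_Icc_mu_right (𝕜 := ℤ) ⊥ x).trans (hg x).symm
    rw [← Finset.Ico_insert_right bot_le, Finset.sum_insert Finset.right_notMem_Ico,
      Finset.sum_insert Finset.right_notMem_Ico,
      Finset.sum_congr rfl fun y hy => ih y (Finset.mem_Ico.1 hy).2] at h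
    exact add_right_cancel h

open Classical in
/-- Whitney's formula: if every element of `α` is a join of the elements `F {e}`, then `μ(⊥, x)` is
the alternating count of the sets with join `x`. -/
lemma IncidenceAlgebra.mu_bot_eq_sum_neg_one_pow {α E : Type*} [PartialOrder α] [OrderBot α]
    [Finite α] [LocallyFiniteOrder α] [DecidableEq α] [Fintype E] {F : Finset E → α}
    (hF : ∀ S x, F S ≤ x ↔ ∀ e ∈ S, F {e} ≤ x) (hsurj : Function.Surjective F)
    (hbot : ∀ e, F {e} ≠ ⊥) (x : α) :
    IncidenceAlgebra.mu ℤ ⊥ x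
      = ∑ S ∈ Finset.univ.filter (fun S : Finset E => F S = x), (-1 : ℤ) ^ S.card := by
  refine mu_bot_eq_of_sum_Icc (g := fun x =>
    ∑ S ∈ Finset.univ.filter (fun S : Finset E => F S = x), (-1 : ℤ) ^ S.card) (fun x => ?_) x
  -- The sets with join at most `x` form a full power set. Its alternating sum vanishes unless no `F
  -- {e}` lies below `x`, which happens only for `x = ⊥`.
  have hset : ∀ S : Finset E, F S ≤ x ↔ S ∈ (Finset.univ.filter fun e => F {e} ≤ x).powerset := by
    intro S
    rw [hF, Finset.mem_powerset]
    exact ⟨fun h e he => Finset.mem_filter.2 ⟨Finset.mem_univ _, h e he⟩,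
      fun h e he => (Finset.mem_filter.1 (h he)).2⟩
  have h1 : ∑ y ∈ Finset.Icc ⊥ x,
      ∑ S ∈ Finset.univ.filter (fun S : Finset E => F S = y), (-1 : ℤ) ^ S.card
      = ∑ S ∈ (Finset.univ.filter fun e => F {e} ≤ x).powerset, (-1 : ℤ) ^ S.card := by
    rw [← Finset.sum_fiberwise_of_maps_to (g := F) (t := Finset.Icc ⊥ x)]
    · refine Finset.sum_congr rfl fun y hy => ?_
      refine Finset.sum_congr ?_ fun _ _ => rfl
      ext S
      rw [Finset.mem_filter, Finset.mem_filter, ← hset]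
      constructor
      · rintro ⟨-, rfl⟩
        exact ⟨(Finset.mem_Icc.1 hy).2, rfl⟩
      · exact fun h => ⟨Finset.mem_univ _, h.2⟩
    · intro S hS
      exact Finset.mem_Icc.2 ⟨bot_le, (hset S).2 hS⟩
  rw [h1, Finset.sum_powerset_neg_one_pow_card]
  refine if_congr ?_ rfl rfl
  rw [Finset.filter_eq_empty_iff]
  constructor
  · intro h
    obtain ⟨S, rfl⟩ := hsurj x
    have hS : S = ∅ := Finset.eq_empty_of_forall_notMem fun e he =>
      h (Finset.mem_univ e) ((hF S _).1 le_rfl e he)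
    subst hS
    exact le_antisymm bot_le ((hF ∅ ⊥).2 (by simp))
  · rintro rfl e _ he
    exact hbot e (le_bot_iff.1 he)

/-! ### The cographic arrangement and its forests -/

namespace DirectedMultigraph

variable {V E : Type*}

/-- The vector `e_i - e_j` of an edge `i → j`, with real coefficients. -/
noncomputable def realEdgeVector (G : DirectedMultigraph V E) (e : E) : V →₀ ℝ :=
  Finsupp.single (G.src e) 1 - Finsupp.single (G.tgt e) 1

lemma realEdgeVector_apply (G : DirectedMultigraph V E) (e : E) (v : V) :
    G.realEdgeVector e v = (G.edgeVector e v : ℝ) := by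
  classical
  rw [realEdgeVector, Finsupp.sub_apply, Finsupp.single_apply, Finsupp.single_apply]
  simp [edgeVector, Pi.single_apply, eq_comm]

lemma exists_realEdgeVector_eq_smul_pairVector (G : DirectedMultigraph V E) (e : E) :
    ∃ c : ℝ, c ≠ 0 ∧ G.realEdgeVector e = c • pairVector s(G.src e, G.tgt e) :=
  exists_single_sub_single_eq_smul_pairVector _ _

lemma exists_realEdgeVector_of_isOrientationOf_top {G : DirectedMultigraph V E}
    (hG : G.IsOrientationOf (⊤ : SimpleGraph V)) {a b : V} (hab : a ≠ b) :
    ∃ (e : E) (c : ℝ), s(G.src e, G.tgt e) = s(a, b) ∧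
      (Finsupp.single a 1 - Finsupp.single b 1 : V →₀ ℝ) = c • G.realEdgeVector e := by
  have hab' : s(a, b) ∈ (⊤ : SimpleGraph V).edgeSet := by simpa using hab
  obtain ⟨e, -, he⟩ := hG.surjOn hab'
  simp only at he
  rcases Sym2.eq_iff.1 he with ⟨h1, h2⟩ | ⟨h1, h2⟩
  · exact ⟨e, 1, he, by rw [realEdgeVector, h1, h2, one_smul]⟩
  · exact ⟨e, -1, he, by rw [realEdgeVector, h1, h2, neg_one_smul, neg_sub]⟩

variable [Fintype E]

lemma mem_flowSpace_iff (G : DirectedMultigraph V E) (c : E → ℝ) :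
    c ∈ G.flowSpace ↔ ∑ e, c e • G.realEdgeVector e = 0 := by
  rw [Finsupp.ext_iff]
  simp only [Finsupp.finsetSum_apply, Finsupp.smul_apply, realEdgeVector_apply, smul_eq_mul,
    Finsupp.zero_apply]
  rfl

lemma mem_hyperplane_iff (G : DirectedMultigraph V E) (e : E) (c : G.flowSpace) :
    c ∈ G.hyperplane e ↔ (c : E → ℝ) e = 0 := Iff.rfl

lemma mem_interHyperplanes_iff (G : DirectedMultigraph V E) (S : Finset E) (c : G.flowSpace) :
    c ∈ G.interHyperplanes S ↔ ∀ e ∈ S, (c : E → ℝ) e = 0 := by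
  simp [interHyperplanes, Submodule.mem_iInf, mem_hyperplane_iff]

-- A flow vanishing on `S`, restricted to the complement, is exactly a linear relation among the
-- edge vectors there.
open Classical in
lemma interHyperplanes_eq_bot_iff (G : DirectedMultigraph V E) (S : Finset E) :
    G.interHyperplanes S = ⊥ ↔ LinearIndepOn ℝ G.realEdgeVector ((Sᶜ : Finset E) : Set E) := by
  rw [linearIndepOn_finset_iff, Submodule.eq_bot_iff]
  constructor
  · intro h f hf e he
    have hc : (fun e => if e ∈ S then 0 else f e) ∈ G.flowSpace := by
      rw [mem_flowSpace_iff, ← Finset.sum_add_sum_compl S,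
        Finset.sum_eq_zero fun e he => by rw [if_pos he, zero_smul], zero_add, ← hf]
      exact Finset.sum_congr rfl fun e he => by rw [if_neg (Finset.mem_compl.1 he)]
    have h0 := h ⟨_, hc⟩ ((G.mem_interHyperplanes_iff S _).2 fun e he => if_pos he)
    have := congrFun (congrArg Subtype.val h0) e
    simpa [Finset.mem_compl.1 he] using this
  · rintro h ⟨c, hc⟩ hcS
    rw [mem_interHyperplanes_iff] at hcS
    simp only at hcS
    rw [mem_flowSpace_iff, ← Finset.sum_add_sum_compl S,
      Finset.sum_eq_zero fun e he => by rw [hcS e he, zero_smul], zero_add] at hc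
    have h0 := h c hc
    refine Subtype.ext (funext fun e => ?_)
    by_cases he : e ∈ S
    · exact hcS e he
    · exact h0 e (Finset.mem_compl.2 he)

lemma interHyperplanes_univ (G : DirectedMultigraph V E) :
    G.interHyperplanes Finset.univ = ⊥ := by
  classical
  rw [interHyperplanes_eq_bot_iff]
  simp

lemma le_interHyperplanes_iff (G : DirectedMultigraph V E) (S : Finset E)
    (X : Submodule ℝ G.flowSpace) : X ≤ G.interHyperplanes S ↔ ∀ e ∈ S, X ≤ G.hyperplane e := by
  simp [interHyperplanes]

open Classical in
lemma abs_mu_bot_top_eq_abs_indepSum (G : DirectedMultigraph V E)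
    (hG : ∀ e, G.hyperplane e ≠ ⊤) :
    |IncidenceAlgebra.mu ℤ (⊥ : G.IntersectionLattice) ⊤|
      = |indepSum G.realEdgeVector (fun _ => (-1 : ℤ))| := by
  have hsingle : ∀ e, G.interHyperplanes {e} = G.hyperplane e := fun e => by
    simp [interHyperplanes]
  rw [IncidenceAlgebra.mu_bot_eq_sum_neg_one_pow (F := fun S : Finset E =>
    (⟨OrderDual.toDual (G.interHyperplanes S), S, rfl⟩ : G.IntersectionLattice))]
  -- Passing to complements changes the sign only by the global factor (-1)^|E|, which the absolute
  -- value removes.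
  · have hterm : ∀ S : Finset E, (-1 : ℤ) ^ S.card
        = (-1) ^ Fintype.card E * ∏ _e ∈ Sᶜ, (-1 : ℤ) := by
      intro S
      rw [Finset.prod_const, ← pow_add, ← Finset.card_add_card_compl S, add_assoc, pow_add,
        ← two_mul, pow_mul (-1 : ℤ) 2]
      simp
    have hsum : ∑ S ∈ Finset.univ.filter (fun S : Finset E =>
        (⟨OrderDual.toDual (G.interHyperplanes S), S, rfl⟩ : G.IntersectionLattice) = ⊤),
          (-1 : ℤ) ^ S.card
        = (-1) ^ Fintype.card E * indepSum G.realEdgeVector (fun _ => (-1 : ℤ)) := by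
      rw [Finset.sum_congr rfl fun S _ => hterm S, ← Finset.mul_sum]
      congr 1
      have htop : ∀ S : Finset E, (⟨OrderDual.toDual (G.interHyperplanes S), S, rfl⟩ :
          G.IntersectionLattice) = ⊤ ↔
          LinearIndepOn ℝ G.realEdgeVector ((Sᶜ : Finset E) : Set E) := by
        intro S
        rw [← interHyperplanes_eq_bot_iff, ← interHyperplanes_univ, Subtype.ext_iff]
        exact OrderDual.toDual_inj
      refine Finset.sum_bij' (fun S _ => Sᶜ) (fun S _ => Sᶜ) ?_ ?_ ?_ ?_ ?_
      · intro S hS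
        exact Finset.mem_filter.2 ⟨Finset.mem_univ _, (htop S).1 (Finset.mem_filter.1 hS).2⟩
      · intro S hS
        refine Finset.mem_filter.2 ⟨Finset.mem_univ _, (htop _).2 ?_⟩
        rw [compl_compl]
        exact (Finset.mem_filter.1 hS).2
      · simp
      · simp
      · simp
    rw [hsum, abs_mul, abs_pow, abs_neg, abs_one, one_pow, one_mul]
  · rintro S ⟨X, T, rfl⟩
    change G.interHyperplanes T ≤ G.interHyperplanes S
      ↔ ∀ e ∈ S, G.interHyperplanes T ≤ G.interHyperplanes {e}
    simp only [hsingle, le_interHyperplanes_iff]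
  · rintro ⟨X, S, rfl⟩
    exact ⟨S, rfl⟩
  · intro e he
    have h : G.interHyperplanes {e} = G.interHyperplanes ∅ :=
      OrderDual.toDual_inj.1 (congrArg Subtype.val he)
    refine hG e ?_
    rw [← hsingle, h]
    simp [interHyperplanes]

lemma indepSum_realEdgeVector_of_isOrientationOf_top [Fintype V] (G : DirectedMultigraph V E)
    (hG : G.IsOrientationOf (⊤ : SimpleGraph V)) :
    indepSum G.realEdgeVector (fun _ => (-1 : ℤ)) = indepSum (pairVector (V := V)) fun _ => -1 := by
  classical
  choose c hc hcv using G.exists_realEdgeVector_eq_smul_pairVector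
  rw [indepSum_eq_indepSum_fiber (fun e => s(G.src e, G.tgt e)) hc hcv]
  refine indepSum_congr fun z hz => ?_
  have hz' : z ∈ (⊤ : SimpleGraph V).edgeSet := by
    induction z with | _ p q
    rw [Ne, pairVector_mk_eq_zero_iff] at hz
    simpa using hz
  obtain ⟨e, -, he⟩ := hG.surjOn hz'
  have hfib : (Finset.univ.filter fun e => s(G.src e, G.tgt e) = z) = {e} := by
    ext e'
    simp only [Finset.mem_filter, Finset.mem_univ, true_and, Finset.mem_singleton]
    constructor
    · intro h
      exact hG.injOn (Set.mem_univ _) (Set.mem_univ _) (h.trans he.symm)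
    · rintro rfl
      exact he
  rw [hfib, Finset.sum_singleton]

/-- A third vertex `k` completes `e` to a triangle, and the flow around it has value 1 on `e`. -/
lemma hyperplane_ne_top_of_isOrientationOf_top [Fintype V] {G : DirectedMultigraph V E}
    (hG : G.IsOrientationOf (⊤ : SimpleGraph V)) (hV : 3 ≤ Fintype.card V) (e : E) :
    G.hyperplane e ≠ ⊤ := by
  classical
  obtain ⟨k, hk⟩ : ∃ k, k ∉ ({G.src e, G.tgt e} : Finset V) := by
    by_contra! h
    have h1 := Finset.card_le_card fun k (_ : k ∈ Finset.univ) => h k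
    have h2 := Finset.card_le_two (a := G.src e) (b := G.tgt e)
    rw [Finset.card_univ] at h1
    omega
  simp only [Finset.mem_insert, Finset.mem_singleton, not_or] at hk
  obtain ⟨e₁, c₁, he₁, hv₁⟩ := exists_realEdgeVector_of_isOrientationOf_top hG (Ne.symm hk.1)
  obtain ⟨e₂, c₂, he₂, hv₂⟩ := exists_realEdgeVector_of_isOrientationOf_top hG hk.2
  have hne₁ : e ≠ e₁ := by
    rintro rfl
    exact hk.2 (Sym2.congr_right.1 he₁).symm
  have hne₂ : e ≠ e₂ := by
    rintro rfl
    exact hk.1 (Sym2.congr_left.1 he₂).symm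
  have hflow : (Pi.single e 1 - c₁ • Pi.single e₁ 1 - c₂ • Pi.single e₂ 1 : E → ℝ)
      ∈ G.flowSpace := by
    rw [mem_flowSpace_iff]
    simp only [Pi.sub_apply, Pi.smul_apply, smul_eq_mul, sub_smul, Finset.sum_sub_distrib, mul_smul,
      Pi.single_apply, ite_smul, one_smul, zero_smul, smul_ite, smul_zero, Finset.sum_ite_eq',
      Finset.mem_univ, if_true, ← hv₁, ← hv₂]
    rw [realEdgeVector]
    abel
  intro htop
  have := (G.mem_hyperplane_iff e ⟨_, hflow⟩).1 (htop ▸ Submodule.mem_top)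
  simp [hne₁, hne₂] at this

end DirectedMultigraph

/-! ### The coinvariant of the complete graph -/

theorem theorem5p5 (m : ℕ) (hm : 2 ≤ m) {E : Type*} [Fintype E]
    (G : DirectedMultigraph (Fin m) E) (hG : G.IsOrientationOf (⊤ : SimpleGraph (Fin m))) :
    G.moebiusCoinvariant
      = ((m : ℤ) - 2) * (matchingHermite ((m : ℤ) - 3)).eval ((m : ℤ) - 1) := by
  classical
  unfold DirectedMultigraph.moebiusCoinvariant
  split_ifs with h
  -- An isthmus forces m = 2, where the factor m - 2 vanishes as well.
  · obtain ⟨e, he⟩ := h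
    have hm2 : m = 2 := by
      by_contra hne
      exact DirectedMultigraph.hyperplane_ne_top_of_isOrientationOf_top hG
        (by rw [Fintype.card_fin]; omega) e he
    simp [hm2]
  · push Not at h
    obtain ⟨n, rfl⟩ : ∃ n, m = n + 2 := ⟨m - 2, by omega⟩
    have e1 : ((n + 2 : ℕ) : ℤ) - 3 = n - 1 := by push_cast; ring
    have e2 : ((n + 2 : ℕ) : ℤ) - 1 = n + 1 := by push_cast; ring
    have e3 : ((n + 2 : ℕ) : ℤ) - 2 = n := by push_cast; ring
    have habs := G.abs_mu_bot_top_eq_abs_indepSum h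
    rw [G.indepSum_realEdgeVector_of_isOrientationOf_top hG,
      indepSum_pairVector_neg_one (Fintype.card_fin (n + 2)), abs_mul, abs_pow, abs_neg, abs_one,
      one_pow, one_mul] at habs
    rw [e1, e2, e3]
    refine Eq.trans ?_ (habs.trans (abs_of_nonneg ?_))
    · congr!
    · refine mul_nonneg (Nat.cast_nonneg n) ?_
      rcases n with _ | k
      · have h0 : matchingHermite (((0 : ℕ) : ℤ) - 1) = 0 := rfl
        simp only [h0, eval_zero, le_refl]
      · have e' : (((k + 1 : ℕ) : ℤ) - 1) = (k : ℤ) := by push_cast; ring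
        rw [e']
        -- As a matching sum, H_k has nonnegative coefficients, so its value at a positive point is
        -- nonnegative and the absolute value can be dropped.
        change 0 ≤ eval _ (∑ M ∈ partialMatchings (⊤ : SimpleGraph (Fin k)), X ^ unmatchedCount M)
        rw [eval_finsetSum]
        refine Finset.sum_nonneg fun M _ => ?_
        rw [eval_pow, eval_X]
        positivity
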